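/- Let $\mathbb{D}=\{z\in\mathbb{C}:|z|<1\}$ and let $f:\mathbb{D}^2\to\mathbb{D}$ be holomorphic. Define the extreme set of $f$ by $$X(f)=\left\{(z,w)\in\mathbb{D}^2 : (1-|z|^2)\left|\frac{\partial f}{\partial z}(z,w)\right|+(1-|w|^2)\left|\frac{\partial f}{\partial w}(z,w)\right| = 1-|f(z,w)|^2\right\}.$$ Call a subset $D\subset\mathbb{D}^2$ a balanced disk if $D=\{(\phi_1(\zeta),\phi_2(\zeta)):\zeta\in\mathbb{D}\}$ for some holomorphic automorphisms $\phi_1,\phi_2$ of $\mathbb{D}$. If there are two balanced disks $D_1\neq D_2$ with $D_1\cap D_2\neq\emptyset$ and $D_1\cup D_2\subset X(f)$, then $f$ is everywhere infinitesimally extremal, i.e. $X(f)=\mathbb{D}^2$. -/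

import Mathlib

/-- The open unit disk in the complex plane. -/
def unitDisk : Set ℂ := Metric.ball 0 1

/-- The open unit bidisk, the product of two unit disks. -/
def bidisk : Set (ℂ × ℂ) := unitDisk ×ˢ unitDisk

/-- `f` restricts to a holomorphic function from the bidisk to the disk
(values of `f` outside the bidisk play no role). -/
def IsHolomorphicBidiskToDisk (f : ℂ × ℂ → ℂ) : Prop :=
  DifferentiableOn ℂ f bidisk ∧ Set.MapsTo f bidisk unitDisk

/-- `φ` restricts to a (holomorphic) automorphism of the unit disk: a holomorphic self-map of the
disk with a holomorphic two-sided inverse. -/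
def IsDiskAutomorphism (φ : ℂ → ℂ) : Prop :=
  DifferentiableOn ℂ φ unitDisk ∧ Set.MapsTo φ unitDisk unitDisk ∧
    ∃ ψ : ℂ → ℂ, DifferentiableOn ℂ ψ unitDisk ∧ Set.MapsTo ψ unitDisk unitDisk ∧
      Set.InvOn ψ φ unitDisk unitDisk

/-- A balanced disk in the bidisk: the image of the unit disk under a pair of automorphisms. -/
def IsBalancedDisk (D : Set (ℂ × ℂ)) : Prop :=
  ∃ φ₁ φ₂ : ℂ → ℂ, IsDiskAutomorphism φ₁ ∧ IsDiskAutomorphism φ₂ ∧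
    D = (fun ζ : ℂ => (φ₁ ζ, φ₂ ζ)) '' unitDisk

/-- The partial derivative of `f` in the first variable. -/
noncomputable def partialFst (f : ℂ × ℂ → ℂ) (p : ℂ × ℂ) : ℂ :=
  deriv (fun ζ : ℂ => f (ζ, p.2)) p.1

/-- The partial derivative of `f` in the second variable. -/
noncomputable def partialSnd (f : ℂ × ℂ → ℂ) (p : ℂ × ℂ) : ℂ :=
  deriv (fun ζ : ℂ => f (p.1, ζ)) p.2

/-- Equality in the infinitesimal Schwarz-Pick inequality on the bidisk, at the point `p`. -/
def SchwarzPickEqualityAt (f : ℂ × ℂ → ℂ) (p : ℂ × ℂ) : Prop :=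
  (1 - ‖p.1‖ ^ 2) * ‖partialFst f p‖ + (1 - ‖p.2‖ ^ 2) * ‖partialSnd f p‖ = 1 - ‖f p‖ ^ 2

/-- The extreme set `X(f)`: the points of the bidisk at which equality holds. -/
def extremeSet (f : ℂ × ℂ → ℂ) : Set (ℂ × ℂ) :=
  {p | p ∈ bidisk ∧ SchwarzPickEqualityAt f p}

/-- `f` is everywhere infinitesimally extremal: equality holds at every point of the bidisk. -/
def EverywhereInfinitesimallyExtremal (f : ℂ × ℂ → ℂ) : Prop :=
  ∀ p ∈ bidisk, SchwarzPickEqualityAt f p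

/-!
Moving a common point of the two balanced disks to the origin by automorphisms, and rotating, one
may assume `f (0, 0) = 0` and that `a = ∂f/∂z` and `b = ∂f/∂w` are nonnegative at the origin;
extremality there says `a + b = 1`. By the Schwarz lemma, balanced disks through the origin are
`{(ζ, β ζ)}` with `‖β‖ = 1`. The disk `β = 1` always lies in the extreme set, since
`f (ζ, ζ) = ζ`; so the hypothesis supplies one disk with `β ≠ 1`.

Consider the slices `u_β ζ = f (ζ, β ζ)`, self-maps of the disk with `u_β 0 = 0` and
`u_β' 0 = a + β b`. The second-order Schwarz lemma gives
`‖u_β'' 0‖ ≤ 2 (1 - ‖u_β' 0‖²) = 2 a b ‖1 - β‖²`. As `u_β'' 0` is the quadratic polynomial in `β`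
whose coefficients are the second derivatives of `f` at the origin, the bound near `β = 1` forces
`u_β'' 0 = A (1 - β)²` with `A = ∂²f/∂z²` (`IsNormalizedExtremal.hessian`), and so
`‖A‖ ≤ 2 a b`.

On the extremal disk `β ≠ 1`, with local square roots `P`, `Q` of the partial derivatives of `f`,
extremality reads `(1 - ‖ζ‖²) (‖P‖² + ‖Q‖²) = 1 - ‖u_β‖²`. Comparing the coefficients of `ζ ζ̄`
gives `‖A‖ = 2 a b` (`IsNormalizedExtremal.norm_partialFst_partialFst`). Hence equality holds in
the second-order Schwarz lemma on all slices at once, which determines every slice: with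
`κ = A / (2 a b)`,
`f (z, w) = (a z + b w - κ z w) / (1 - κ (b z + a w))` on `‖z‖ = ‖w‖`, and then on the whole
bidisk by the identity theorem. For this rational function equality holds everywhere by an
explicit computation (`everywhere_extremal_of_eq`). If `a = 0` or `b = 0` the slices are rotations
and the same formula holds with `κ = 1`.
-/

open Metric Set Filter Topology
open scoped ComplexConjugate

/-! ### Regularity of holomorphic functions of two variables -/

lemma isOpen_unitDisk : IsOpen unitDisk := Metric.isOpen_ball

lemma isOpen_bidisk : IsOpen bidisk := isOpen_unitDisk.prod isOpen_unitDisk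

lemma mem_unitDisk {z : ℂ} : z ∈ unitDisk ↔ ‖z‖ < 1 := by simp [unitDisk]

lemma mem_bidisk {p : ℂ × ℂ} : p ∈ bidisk ↔ ‖p.1‖ < 1 ∧ ‖p.2‖ < 1 := by
  simp [bidisk, mem_prod, mem_unitDisk]

/-- Directional derivatives of a holomorphic function of two variables are holomorphic: near a
point they are given by Cauchy's integral formula along complex lines, which may be differentiated
under the integral sign because the derivative of `f` is locally bounded. -/
theorem differentiableOn_fderiv_apply {f : ℂ × ℂ → ℂ} {U : Set (ℂ × ℂ)} (hU : IsOpen U)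
    (hf : DifferentiableOn ℂ f U) (v : ℂ × ℂ) :
    DifferentiableOn ℂ (fun x => fderiv ℂ f x v) U := by
  intro x₀ hx₀
  refine DifferentiableAt.differentiableWithinAt ?_
  have hcont : ContinuousAt f x₀ := (hf.differentiableAt (hU.mem_nhds hx₀)).continuousAt
  obtain ⟨R, hR, hball⟩ : ∃ R > 0, ball x₀ (3 * R) ⊆ U ∩ f ⁻¹' ball (f x₀) 1 := by
    obtain ⟨ε, hε, h⟩ := Metric.mem_nhds_iff.1
      (inter_mem (hU.mem_nhds hx₀) (hcont.preimage_mem_nhds (ball_mem_nhds _ one_pos)))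
    exact ⟨ε / 3, by positivity, by rwa [mul_div_cancel₀ _ (by norm_num)]⟩
  have hmemU : ∀ y ∈ ball x₀ (3 * R), y ∈ U := fun y hy => (hball hy).1
  have hdiff : ∀ y ∈ ball x₀ (3 * R), DifferentiableAt ℂ f y := fun y hy =>
    hf.differentiableAt (hU.mem_nhds (hmemU y hy))
  have hbound : ∀ y ∈ ball x₀ (2 * R), ‖fderiv ℂ f y‖ ≤ 2 / R := by
    intro y hy
    have hsub : ball y R ⊆ ball x₀ (3 * R) := by
      intro z hz
      rw [mem_ball] at *
      linarith [dist_triangle z y x₀]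
    refine Complex.norm_fderiv_le_div_of_mapsTo_ball
      (hf.mono fun z hz => hmemU z (hsub hz)) ?_ hR
    intro z hz
    have h1 := (hball (hsub hz)).2
    have h2 := (hball (hsub (mem_ball_self hR))).2
    simp only [mem_preimage, mem_ball, mem_closedBall] at *
    linarith [dist_triangle_right (f z) (f y) (f x₀)]
  obtain ⟨ρ, hρ, hρv⟩ : ∃ ρ > 0, ρ * ‖v‖ < R := by
    refine ⟨R / (‖v‖ + 1), by positivity, ?_⟩
    rw [div_mul_eq_mul_div, div_lt_iff₀ (by positivity)]
    nlinarith
  have hshift : ∀ x ∈ ball x₀ R, ∀ t : ℂ, ‖t‖ ≤ ρ → x + t • v ∈ ball x₀ (2 * R) := by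
    intro x hx t ht
    rw [mem_ball] at *
    have h1 : dist (x + t • v) x ≤ ρ * ‖v‖ := by
      rw [dist_eq_norm, add_sub_cancel_left, norm_smul]
      gcongr
    linarith [dist_triangle (x + t • v) x x₀]
  have hcircle : ∀ θ : ℝ, ‖circleMap 0 ρ θ‖ ≤ ρ := fun θ => by simp [abs_of_pos hρ]
  set w : ℝ → ℂ := fun θ => deriv (circleMap 0 ρ) θ * ((circleMap 0 ρ θ - 0) ^ 2)⁻¹ with hw
  have hw_cont : Continuous w := by
    have : ∀ θ, circleMap 0 ρ θ - 0 ≠ 0 := fun θ => by simp [hρ.ne']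
    simp only [hw, deriv_circleMap]
    fun_prop (disch := simpa using this)
  have hw_norm : ∀ θ, ‖w θ‖ = ρ⁻¹ := fun θ => by
    simp only [hw, deriv_circleMap, norm_mul, norm_inv, norm_pow, sub_zero, norm_circleMap_zero,
      Complex.norm_I, abs_of_pos hρ]
    field_simp
  -- Cauchy's integral formula for the derivative along `v`
  have hformula : ∀ x ∈ ball x₀ R, fderiv ℂ f x v = (2 * Real.pi * Complex.I : ℂ)⁻¹ •
      ∫ θ in (0 : ℝ)..2 * Real.pi, w θ • f (x + circleMap 0 ρ θ • v) := by
    intro x hx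
    have hline : ∀ t : ℂ, HasDerivAt (fun t : ℂ => x + t • v) v t := fun t => by
      simpa using ((hasDerivAt_id t).smul_const v).const_add x
    have hc := Complex.two_pi_I_inv_smul_circleIntegral_sub_sq_inv_smul_of_differentiable
      (U := (fun t : ℂ => x + t • v) ⁻¹' ball x₀ (3 * R)) (c := 0) (R := ρ) (w₀ := 0)
      (f := fun t : ℂ => f (x + t • v)) (isOpen_ball.preimage (by fun_prop))
      (fun t ht => ball_subset_ball (by linarith) (hshift x hx t (by simpa using ht)))
      (fun t ht => (DifferentiableAt.comp t (hdiff _ ht)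
        (hline t).differentiableAt).differentiableWithinAt) (mem_ball_self hρ)
    have hx' : HasFDerivAt f (fderiv ℂ f x) (x + (0 : ℂ) • v) := by
      simpa using (hdiff x (ball_subset_ball (by linarith) hx)).hasFDerivAt
    have hderiv : deriv (fun t : ℂ => f (x + t • v)) 0 = fderiv ℂ f x v :=
      (hx'.comp_hasDerivAt (0 : ℂ) (hline 0)).deriv
    rw [← hderiv, ← hc]
    simp only [circleIntegral, hw, smul_eq_mul, mul_assoc]
  have hcurve : ∀ x ∈ ball x₀ R, Continuous fun θ => f (x + circleMap 0 ρ θ • v) := by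
    intro x hx
    rw [continuous_iff_continuousAt]
    intro θ
    refine ContinuousAt.comp (f := fun θ => x + circleMap 0 ρ θ • v)
      (hdiff _ (ball_subset_ball (by linarith) (hshift x hx _ (hcircle θ)))).continuousAt ?_
    exact Continuous.continuousAt (by fun_prop)
  have hint := intervalIntegral.hasFDerivAt_integral_of_dominated_of_fderiv_le
    (μ := MeasureTheory.volume) (a := 0) (b := 2 * Real.pi) (𝕜 := ℂ)
    (F := fun x θ => w θ • f (x + circleMap 0 ρ θ • v))
    (F' := fun x θ => w θ • fderiv ℂ f (x + circleMap 0 ρ θ • v))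
    (x₀ := x₀) (s := ball x₀ R) (bound := fun _ => ρ⁻¹ * (2 / R)) (ball_mem_nhds _ hR)
    (by
      filter_upwards [ball_mem_nhds x₀ hR] with x hx
      exact (hw_cont.smul (hcurve x hx)).aestronglyMeasurable)
    ((hw_cont.smul (hcurve x₀ (mem_ball_self hR))).intervalIntegrable _ _)
    (by
      refine (hw_cont.aestronglyMeasurable).smul ?_
      refine Measurable.aestronglyMeasurable ?_
      exact (measurable_fderiv ℂ f).comp (Continuous.measurable (by fun_prop)))
    (by
      refine Eventually.of_forall fun θ _ x hx => ?_
      rw [norm_smul, hw_norm]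
      gcongr
      exact hbound _ (hshift x hx _ (hcircle θ)))
    (by simp)
    (by
      refine Eventually.of_forall fun θ _ x hx => ?_
      have h1 := (hdiff _ (ball_subset_ball (by linarith) (hshift x hx _ (hcircle θ)))).hasFDerivAt
      have h2 := h1.comp x (f := fun x => x + circleMap 0 ρ θ • v) ((hasFDerivAt_id x).add_const _)
      exact h2.const_smul (w θ))
  have hres := (hint.const_smul ((2 * Real.pi * Complex.I : ℂ)⁻¹)).differentiableAt
  refine hres.congr_of_eventuallyEq ?_
  filter_upwards [ball_mem_nhds x₀ hR] with x hx using hformula x hx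

lemma partialFst_eq_fderiv {f : ℂ × ℂ → ℂ} {p : ℂ × ℂ} (hf : DifferentiableAt ℂ f p) :
    partialFst f p = fderiv ℂ f p (1, 0) :=
  (HasFDerivAt.comp_hasDerivAt (f := fun ζ : ℂ => (ζ, p.2)) p.1 hf.hasFDerivAt
    ((hasDerivAt_id p.1).prodMk (hasDerivAt_const p.1 p.2))).deriv

lemma partialSnd_eq_fderiv {f : ℂ × ℂ → ℂ} {p : ℂ × ℂ} (hf : DifferentiableAt ℂ f p) :
    partialSnd f p = fderiv ℂ f p (0, 1) :=
  (HasFDerivAt.comp_hasDerivAt (f := fun ζ : ℂ => (p.1, ζ)) p.2 hf.hasFDerivAt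
    ((hasDerivAt_const p.2 p.1).prodMk (hasDerivAt_id p.2))).deriv

/-- The chain rule along a curve, in terms of partial derivatives. -/
lemma hasDerivAt_comp_prodMk {f : ℂ × ℂ → ℂ} {g h : ℂ → ℂ} {g' h' ζ : ℂ}
    (hf : DifferentiableAt ℂ f (g ζ, h ζ)) (hg : HasDerivAt g g' ζ) (hh : HasDerivAt h h' ζ) :
    HasDerivAt (fun ζ => f (g ζ, h ζ))
      (g' * partialFst f (g ζ, h ζ) + h' * partialSnd f (g ζ, h ζ)) ζ := by
  have h1 := HasFDerivAt.comp_hasDerivAt (f := fun ζ : ℂ => (g ζ, h ζ)) ζ hf.hasFDerivAt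
    (hg.prodMk hh)
  have h2 : fderiv ℂ f (g ζ, h ζ) (g', h') =
      g' * partialFst f (g ζ, h ζ) + h' * partialSnd f (g ζ, h ζ) := by
    rw [partialFst_eq_fderiv hf, partialSnd_eq_fderiv hf, ← smul_eq_mul, ← smul_eq_mul,
      ← map_smul, ← map_smul, ← map_add]
    simp
  rwa [h2] at h1

theorem differentiableOn_partialFst {f : ℂ × ℂ → ℂ} (hf : DifferentiableOn ℂ f bidisk) :
    DifferentiableOn ℂ (partialFst f) bidisk :=
  (differentiableOn_fderiv_apply isOpen_bidisk hf (1, 0)).congr fun _ hp =>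
    partialFst_eq_fderiv (hf.differentiableAt (isOpen_bidisk.mem_nhds hp))

theorem differentiableOn_partialSnd {f : ℂ × ℂ → ℂ} (hf : DifferentiableOn ℂ f bidisk) :
    DifferentiableOn ℂ (partialSnd f) bidisk :=
  (differentiableOn_fderiv_apply isOpen_bidisk hf (0, 1)).congr fun _ hp =>
    partialSnd_eq_fderiv (hf.differentiableAt (isOpen_bidisk.mem_nhds hp))

/-- The mixed second partial derivatives of a holomorphic function agree. -/
theorem partialSnd_partialFst_eq {f : ℂ × ℂ → ℂ} (hf : DifferentiableOn ℂ f bidisk)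
    {p : ℂ × ℂ} (hp : p ∈ bidisk) :
    partialSnd (partialFst f) p = partialFst (partialSnd f) p := by
  have hmem := isOpen_bidisk.mem_nhds hp
  have hdiff : ∀ q ∈ bidisk, DifferentiableAt ℂ f q := fun q hq =>
    hf.differentiableAt (isOpen_bidisk.mem_nhds hq)
  have h1 := (differentiableOn_partialFst hf).differentiableAt hmem
  have h2 := (differentiableOn_partialSnd hf).differentiableAt hmem
  -- the Fréchet derivative is recovered from the two partial derivatives
  have hrep : ∀ q ∈ bidisk, fderiv ℂ f q = partialFst f q • ContinuousLinearMap.fst ℂ ℂ ℂ +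
      partialSnd f q • ContinuousLinearMap.snd ℂ ℂ ℂ := by
    intro q hq
    rw [partialFst_eq_fderiv (hdiff q hq), partialSnd_eq_fderiv (hdiff q hq)]
    ext <;> simp
  have h3 : HasFDerivAt (fderiv ℂ f) _ p :=
    ((h1.hasFDerivAt.smul_const (ContinuousLinearMap.fst ℂ ℂ ℂ)).add
      (h2.hasFDerivAt.smul_const (ContinuousLinearMap.snd ℂ ℂ ℂ))).congr_of_eventuallyEq
      (Filter.eventually_of_mem hmem hrep)
  have hsymm := second_derivative_symmetric_of_eventually
    (Filter.eventually_of_mem hmem fun q hq => (hdiff q hq).hasFDerivAt) h3 (1, 0) (0, 1)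
  rw [partialSnd_eq_fderiv h1, partialFst_eq_fderiv h2]
  simpa using hsymm.symm

/-! ### Automorphisms of the disk and balanced disks -/

/-- The Möbius map `z ↦ (z + c) / (1 + c̄ z)`, which for `‖c‖ < 1` is the automorphism of the
unit disk moving `0` to `c` with positive derivative. -/
noncomputable def diskMobius (c z : ℂ) : ℂ := (z + c) / (1 + conj c * z)

/-- The identity behind the invariance of the Poincaré metric under `diskMobius c`. -/
lemma normSq_one_add_conj_mul_sub (c z : ℂ) :
    ‖1 + conj c * z‖ ^ 2 - ‖z + c‖ ^ 2 = (1 - ‖z‖ ^ 2) * (1 - ‖c‖ ^ 2) := by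
  simp only [Complex.sq_norm, Complex.normSq_apply, Complex.add_re, Complex.add_im,
    Complex.mul_re, Complex.mul_im, Complex.conj_re, Complex.conj_im, Complex.one_re,
    Complex.one_im]
  ring

lemma one_add_conj_mul_ne_zero {c z : ℂ} (hc : ‖c‖ ≤ 1) (hz : ‖z‖ < 1) : 1 + conj c * z ≠ 0 := by
  intro h
  have h1 : ‖conj c * z‖ = 1 := by
    rw [eq_neg_of_add_eq_zero_right h, norm_neg, norm_one]
  rw [norm_mul, Complex.norm_conj] at h1
  nlinarith [norm_nonneg c, norm_nonneg z]

lemma one_sub_sq_norm_diskMobius {c z : ℂ} (hc : ‖c‖ < 1) (hz : ‖z‖ < 1) :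
    1 - ‖diskMobius c z‖ ^ 2 = (1 - ‖z‖ ^ 2) * (1 - ‖c‖ ^ 2) / ‖1 + conj c * z‖ ^ 2 := by
  have h := norm_ne_zero_iff.2 (one_add_conj_mul_ne_zero hc.le hz)
  rw [← normSq_one_add_conj_mul_sub, diskMobius, norm_div, div_pow, sub_div,
    div_self (pow_ne_zero 2 h)]

lemma sq_norm_lt_one {z : ℂ} (hz : ‖z‖ < 1) : 0 < 1 - ‖z‖ ^ 2 := by
  nlinarith [norm_nonneg z]

lemma norm_diskMobius_lt_one {c z : ℂ} (hc : ‖c‖ < 1) (hz : ‖z‖ < 1) : ‖diskMobius c z‖ < 1 := by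
  have h1 := norm_pos_iff.2 (one_add_conj_mul_ne_zero hc.le hz)
  have h2 : 0 < 1 - ‖diskMobius c z‖ ^ 2 := by
    rw [one_sub_sq_norm_diskMobius hc hz]
    have := sq_norm_lt_one hc
    have := sq_norm_lt_one hz
    positivity
  nlinarith [norm_nonneg (diskMobius c z)]

lemma hasDerivAt_diskMobius {c z : ℂ} (hc : ‖c‖ < 1) (hz : ‖z‖ < 1) :
    HasDerivAt (diskMobius c) ((1 - ‖c‖ ^ 2 : ℝ) / (1 + conj c * z) ^ 2) z := by
  have h1 : HasDerivAt (fun z => 1 + conj c * z) (conj c) z := by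
    simpa using ((hasDerivAt_id z).const_mul (conj c)).const_add 1
  refine (((hasDerivAt_id z).add_const c).div h1
    (one_add_conj_mul_ne_zero hc.le hz)).congr_deriv ?_
  have h2 : ((‖c‖ : ℂ)) ^ 2 = conj c * c := by rw [Complex.conj_mul']
  congr 1
  push_cast
  rw [h2]
  simp only [id]
  ring

lemma diskMobius_zero (c : ℂ) : diskMobius c 0 = c := by simp [diskMobius]

lemma diskMobius_neg_self (c : ℂ) : diskMobius (-c) c = 0 := by simp [diskMobius]

lemma diskMobius_diskMobius_neg {c z : ℂ} (hc : ‖c‖ < 1) (hz : ‖z‖ < 1) :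
    diskMobius c (diskMobius (-c) z) = z := by
  have h1 : 1 - conj c * z ≠ 0 := by
    simpa [sub_eq_add_neg] using
      one_add_conj_mul_ne_zero (c := -c) (by simpa using hc.le) hz
  have h2 : 1 + conj c * diskMobius (-c) z ≠ 0 :=
    one_add_conj_mul_ne_zero hc.le (norm_diskMobius_lt_one (by simpa using hc) hz)
  rw [diskMobius, div_eq_iff h2]
  have h3 : diskMobius (-c) z * (1 - conj c * z) = z - c := by
    simp only [diskMobius, map_neg, neg_mul, ← sub_eq_add_neg]
    exact div_mul_cancel₀ _ h1
  apply mul_right_cancel₀ h1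
  linear_combination (1 - z * conj c) * h3

lemma diskMobius_neg_diskMobius {c z : ℂ} (hc : ‖c‖ < 1) (hz : ‖z‖ < 1) :
    diskMobius (-c) (diskMobius c z) = z := by
  simpa using diskMobius_diskMobius_neg (c := -c) (by simpa using hc) hz

/-- `φ` is a holomorphic self-map of the unit disk that preserves the Poincaré metric. -/
structure PreservesPoincare (φ : ℂ → ℂ) : Prop where
  differentiableOn : DifferentiableOn ℂ φ unitDisk
  mapsTo : MapsTo φ unitDisk unitDisk
  norm_deriv : ∀ ζ ∈ unitDisk, (1 - ‖ζ‖ ^ 2) * ‖deriv φ ζ‖ = 1 - ‖φ ζ‖ ^ 2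

lemma preservesPoincare_diskMobius {c : ℂ} (hc : ‖c‖ < 1) : PreservesPoincare (diskMobius c) where
  differentiableOn := fun z hz =>
    (hasDerivAt_diskMobius hc (mem_unitDisk.1 hz)).differentiableAt.differentiableWithinAt
  mapsTo := fun z hz => mem_unitDisk.2 (norm_diskMobius_lt_one hc (mem_unitDisk.1 hz))
  norm_deriv := fun z hz => by
    have hz' := mem_unitDisk.1 hz
    rw [one_sub_sq_norm_diskMobius hc hz', (hasDerivAt_diskMobius hc hz').deriv, norm_div,
      norm_pow, Complex.norm_real, Real.norm_of_nonneg (sq_norm_lt_one hc).le]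
    ring

lemma preservesPoincare_diskMobius_mul {c μ : ℂ} (hc : ‖c‖ < 1) (hμ : ‖μ‖ = 1) :
    PreservesPoincare (fun z => diskMobius c (μ * z)) := by
  have hmem : ∀ z ∈ unitDisk, μ * z ∈ unitDisk := fun z hz => by
    simpa [mem_unitDisk, hμ] using hz
  have hd : ∀ z ∈ unitDisk, HasDerivAt (fun z => diskMobius c (μ * z))
      (deriv (diskMobius c) (μ * z) * μ) z := fun z hz => by
    have h1 := (hasDerivAt_diskMobius hc (mem_unitDisk.1 (hmem z hz))).differentiableAt.hasDerivAt
    exact HasDerivAt.comp z h1 (by simpa using (hasDerivAt_id z).const_mul μ)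
  refine ⟨fun z hz => (hd z hz).differentiableAt.differentiableWithinAt,
    fun z hz => (preservesPoincare_diskMobius hc).mapsTo (hmem z hz), fun z hz => ?_⟩
  rw [(hd z hz).deriv, ← (preservesPoincare_diskMobius hc).norm_deriv _ (hmem z hz)]
  simp [hμ]

/-- Composing with Poincaré isometries on both sides transports the extreme set. -/
theorem schwarzPickEqualityAt_comp {f : ℂ × ℂ → ℂ} (hf : IsHolomorphicBidiskToDisk f)
    {φ ψ τ : ℂ → ℂ} (hφ : PreservesPoincare φ) (hψ : PreservesPoincare ψ)
    (hτ : PreservesPoincare τ) {p : ℂ × ℂ} (hp : p ∈ bidisk) :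
    SchwarzPickEqualityAt (fun q => τ (f (φ q.1, ψ q.2))) p ↔
      SchwarzPickEqualityAt f (φ p.1, ψ p.2) := by
  obtain ⟨hp1, hp2⟩ : p.1 ∈ unitDisk ∧ p.2 ∈ unitDisk := hp
  have hmem : (φ p.1, ψ p.2) ∈ bidisk := ⟨hφ.mapsTo hp1, hψ.mapsTo hp2⟩
  have hfd := hf.1.differentiableAt (isOpen_bidisk.mem_nhds hmem)
  have hft := hf.2 hmem
  have hd : ∀ {χ : ℂ → ℂ} {z : ℂ}, PreservesPoincare χ → z ∈ unitDisk →
      HasDerivAt χ (deriv χ z) z := fun hχ hz =>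
    (hχ.differentiableOn.differentiableAt (isOpen_unitDisk.mem_nhds hz)).hasDerivAt
  have h1 : partialFst (fun q => τ (f (φ q.1, ψ q.2))) p =
      deriv τ (f (φ p.1, ψ p.2)) * (deriv φ p.1 * partialFst f (φ p.1, ψ p.2)) := by
    have := hasDerivAt_comp_prodMk (f := f) (h := fun _ => ψ p.2) hfd (hd hφ hp1)
      (hasDerivAt_const p.1 (ψ p.2))
    have h := (HasDerivAt.comp p.1 (hd hτ hft) this).deriv
    rw [zero_mul, add_zero] at h
    exact h
  have h2 : partialSnd (fun q => τ (f (φ q.1, ψ q.2))) p =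
      deriv τ (f (φ p.1, ψ p.2)) * (deriv ψ p.2 * partialSnd f (φ p.1, ψ p.2)) := by
    have := hasDerivAt_comp_prodMk (f := f) (g := fun _ => φ p.1) hfd
      (hasDerivAt_const p.2 (φ p.1)) (hd hψ hp2)
    have h := (HasDerivAt.comp p.2 (hd hτ hft) this).deriv
    rw [zero_mul, zero_add] at h
    exact h
  have hτ1 := hτ.norm_deriv _ hft
  have hτpos := sq_norm_lt_one (mem_unitDisk.1 (hτ.mapsTo hft))
  have hdpos : ‖deriv τ (f (φ p.1, ψ p.2))‖ ≠ 0 := by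
    intro h0
    rw [h0] at hτ1
    linarith
  unfold SchwarzPickEqualityAt
  simp only
  rw [h1, h2, ← hτ1, ← hφ.norm_deriv _ hp1, ← hψ.norm_deriv _ hp2]
  simp only [norm_mul]
  constructor <;> intro h
  · apply mul_left_cancel₀ hdpos
    linear_combination h
  · linear_combination ‖deriv τ (f (φ p.1, ψ p.2))‖ * h

lemma IsDiskAutomorphism.comp {φ χ : ℂ → ℂ} (hφ : IsDiskAutomorphism φ)
    (hχ : IsDiskAutomorphism χ) : IsDiskAutomorphism (φ ∘ χ) := by
  obtain ⟨hφd, hφm, φ', hφ'd, hφ'm, hφi⟩ := hφ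
  obtain ⟨hχd, hχm, χ', hχ'd, hχ'm, hχi⟩ := hχ
  exact ⟨hφd.comp hχd hχm, hφm.comp hχm, χ' ∘ φ', hχ'd.comp hφ'd hφ'm, hχ'm.comp hφ'm,
    fun z hz => by simp [hφi.1 (hχm hz), hχi.1 hz],
    fun z hz => by simp [hχi.2 (hφ'm hz), hφi.2 hz]⟩

lemma isDiskAutomorphism_diskMobius {c : ℂ} (hc : ‖c‖ < 1) :
    IsDiskAutomorphism (diskMobius c) := by
  have hc' : ‖-c‖ < 1 := by simpa using hc
  exact ⟨(preservesPoincare_diskMobius hc).differentiableOn,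
    (preservesPoincare_diskMobius hc).mapsTo, diskMobius (-c),
    (preservesPoincare_diskMobius hc').differentiableOn,
    (preservesPoincare_diskMobius hc').mapsTo,
    fun z hz => diskMobius_neg_diskMobius hc (mem_unitDisk.1 hz),
    fun z hz => diskMobius_diskMobius_neg hc (mem_unitDisk.1 hz)⟩

/-- The equality case of the Schwarz lemma: a self-map of the disk fixing `0` with unimodular
derivative there is a rotation. -/
lemma eq_mul_of_norm_deriv_eq_one {u : ℂ → ℂ} (hu : DifferentiableOn ℂ u unitDisk)
    (hmaps : MapsTo u unitDisk unitDisk) (h0 : u 0 = 0) (h1 : ‖deriv u 0‖ = 1) {ζ : ℂ}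
    (hζ : ζ ∈ unitDisk) : u ζ = deriv u 0 * ζ := by
  have := Complex.affine_of_mapsTo_ball_of_norm_dslope_eq_div (c := 0) (z₀ := 0) (R₁ := 1)
    (R₂ := 1) hu (by rw [h0]; exact hmaps.mono_right ball_subset_closedBall)
    (mem_ball_self one_pos) (by simpa using h1) hζ
  simpa [h0, mul_comm] using this

lemma norm_deriv_zero_le_one {u : ℂ → ℂ} (hu : DifferentiableOn ℂ u unitDisk)
    (hmaps : MapsTo u unitDisk unitDisk) (h0 : u 0 = 0) : ‖deriv u 0‖ ≤ 1 :=
  Complex.norm_deriv_le_one_of_mapsTo_ball hu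
    (by rw [h0]; exact hmaps.mono_right ball_subset_closedBall) one_pos

/-- An automorphism of the disk fixing `0` is a rotation. -/
lemma IsDiskAutomorphism.eq_mul {φ : ℂ → ℂ} (hφ : IsDiskAutomorphism φ) (h0 : φ 0 = 0) :
    ∃ α : ℂ, ‖α‖ = 1 ∧ ∀ ζ ∈ unitDisk, φ ζ = α * ζ := by
  obtain ⟨hd, hm, ψ, hψd, hψm, hinv⟩ := hφ
  have hz : (0 : ℂ) ∈ unitDisk := mem_unitDisk.2 (by simp)
  have hnhds := isOpen_unitDisk.mem_nhds hz
  have hψ0 : ψ 0 = 0 := by simpa [h0] using hinv.1 hz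
  have hle := norm_deriv_zero_le_one hd hm h0
  have hψle := norm_deriv_zero_le_one hψd hψm hψ0
  -- both derivatives have modulus at most one, and they are inverse to each other
  have hprod : deriv ψ 0 * deriv φ 0 = 1 := by
    have h1 : HasDerivAt ψ (deriv ψ 0) (φ 0) := by
      rw [h0]; exact (hψd.differentiableAt hnhds).hasDerivAt
    have h2 := HasDerivAt.comp 0 h1 (hd.differentiableAt hnhds).hasDerivAt
    refine h2.unique ((hasDerivAt_id (0 : ℂ)).congr_of_eventuallyEq ?_)
    filter_upwards [hnhds] with z hz using hinv.1 hz
  have hnorm : ‖deriv ψ 0‖ * ‖deriv φ 0‖ = 1 := by rw [← norm_mul, hprod, norm_one]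
  have h1 : ‖deriv φ 0‖ = 1 := by
    nlinarith [norm_nonneg (deriv ψ 0), norm_nonneg (deriv φ 0)]
  exact ⟨deriv φ 0, h1, fun ζ hζ => eq_mul_of_norm_deriv_eq_one hd hm h0 h1 hζ⟩

/-- A balanced disk through `p` is, in the coordinates given by the Möbius maps at `p`, a disk
`{(z, γ z)}` with `γ` unimodular. -/
theorem IsBalancedDisk.exists_eq_image {D : Set (ℂ × ℂ)} (hD : IsBalancedDisk D) {p : ℂ × ℂ}
    (hp : p ∈ D) : ∃ γ : ℂ, ‖γ‖ = 1 ∧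
      D = (fun ζ : ℂ => (diskMobius p.1 ζ, diskMobius p.2 (γ * ζ))) '' unitDisk := by
  obtain ⟨φ₁, φ₂, h₁, h₂, rfl⟩ := hD
  obtain ⟨ζ₀, hζ₀, rfl⟩ := hp
  simp only
  have hn := mem_unitDisk.1 hζ₀
  have hn₁ := mem_unitDisk.1 (h₁.2.1 hζ₀)
  have hn₂ := mem_unitDisk.1 (h₂.2.1 hζ₀)
  have key : ∀ φ : ℂ → ℂ, IsDiskAutomorphism φ → ‖φ ζ₀‖ < 1 → ∃ α : ℂ, ‖α‖ = 1 ∧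
      ∀ ζ ∈ unitDisk, φ (diskMobius ζ₀ ζ) = diskMobius (φ ζ₀) (α * ζ) := by
    intro φ hφ hnφ
    obtain ⟨α, hα, h⟩ := ((isDiskAutomorphism_diskMobius (c := -φ ζ₀) (by simpa using hnφ)).comp
      (hφ.comp (isDiskAutomorphism_diskMobius hn))).eq_mul
      (by simp [diskMobius_zero, diskMobius_neg_self])
    refine ⟨α, hα, fun ζ hζ => ?_⟩
    rw [← h ζ hζ]
    exact (diskMobius_diskMobius_neg hnφ (mem_unitDisk.1
      (hφ.2.1 ((isDiskAutomorphism_diskMobius hn).2.1 hζ)))).symm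
  obtain ⟨α, hα, hA⟩ := key φ₁ h₁ hn₁
  obtain ⟨α', hα', hB⟩ := key φ₂ h₂ hn₂
  have hα0 : α ≠ 0 := norm_ne_zero_iff.1 (by rw [hα]; exact one_ne_zero)
  refine ⟨α' * α⁻¹, by simp [hα, hα'], ?_⟩
  ext q
  constructor
  · rintro ⟨ζ, hζ, rfl⟩
    have hζ' : diskMobius (-ζ₀) ζ ∈ unitDisk :=
      (isDiskAutomorphism_diskMobius (by simpa using hn)).2.1 hζ
    have hback := diskMobius_diskMobius_neg hn (mem_unitDisk.1 hζ)
    refine ⟨α * diskMobius (-ζ₀) ζ, by simpa [mem_unitDisk, hα] using hζ', ?_⟩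
    simp only
    rw [← mul_assoc, inv_mul_cancel_right₀ hα0, ← hA _ hζ', ← hB _ hζ', hback]
  · rintro ⟨ζ, hζ, rfl⟩
    have hζ' : α⁻¹ * ζ ∈ unitDisk := by simpa [mem_unitDisk, hα] using hζ
    refine ⟨diskMobius ζ₀ (α⁻¹ * ζ), (isDiskAutomorphism_diskMobius hn).2.1 hζ', ?_⟩
    simp only
    rw [hA _ hζ', hB _ hζ', mul_inv_cancel_left₀ hα0, mul_assoc]

/-! ### The second-order Schwarz lemma -/

/-- The second derivative at a zero of `u` is twice the derivative of `u z / z`. -/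
lemma deriv_deriv_zero_eq_dslope {u : ℂ → ℂ} (hu : DifferentiableOn ℂ u unitDisk) (h0 : u 0 = 0) :
    deriv (deriv u) 0 = 2 * deriv (dslope u 0) 0 := by
  have hnhds : unitDisk ∈ 𝓝 (0 : ℂ) := isOpen_unitDisk.mem_nhds (mem_unitDisk.2 (by simp))
  have hm : DifferentiableOn ℂ (dslope u 0) unitDisk := (Complex.differentiableOn_dslope hnhds).2 hu
  have hmul : ∀ z, u z = z * dslope u 0 z := fun z => by
    simpa [h0] using (sub_smul_dslope u 0 z).symm
  have hd : ∀ z ∈ unitDisk, deriv u z = dslope u 0 z + z * deriv (dslope u 0) z := by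
    intro z hz
    have h1 := (hm.differentiableAt (isOpen_unitDisk.mem_nhds hz)).hasDerivAt
    have h2 := (hasDerivAt_id z).mul h1
    have h3 : u = fun z => z * dslope u 0 z := funext hmul
    rw [h3]
    simp only [id, one_mul] at h2
    have h4 : (fun z => z * dslope u 0 z) = id * dslope u 0 := rfl
    rw [h4, h2.deriv, ← h4, ← h3]
  have hmd := hm.deriv isOpen_unitDisk
  have h5 : HasDerivAt (fun z => dslope u 0 z + z * deriv (dslope u 0) z)
      (deriv (dslope u 0) 0 + (1 * deriv (dslope u 0) 0 + 0 * deriv (deriv (dslope u 0)) 0)) 0 :=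
    (hm.differentiableAt hnhds).hasDerivAt.add
      ((hasDerivAt_id (0 : ℂ)).mul (hmd.differentiableAt hnhds).hasDerivAt)
  have h6 := h5.congr_of_eventuallyEq (Filter.eventually_of_mem hnhds hd)
  rw [h6.deriv]
  ring

/-- If `u` is a self-map of the disk fixing `0` that is not a rotation, the quotient `u z / z`,
moved to `0` by a Möbius map, is again a self-map of the disk fixing `0`. -/
theorem exists_schwarz_quotient {u : ℂ → ℂ} (hu : DifferentiableOn ℂ u unitDisk)
    (hmaps : MapsTo u unitDisk unitDisk) (h0 : u 0 = 0) (h1 : ‖deriv u 0‖ < 1) :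
    ∃ y : ℂ → ℂ, DifferentiableOn ℂ y unitDisk ∧ MapsTo y unitDisk unitDisk ∧ y 0 = 0 ∧
      deriv y 0 = deriv (deriv u) 0 / (2 * (1 - ‖deriv u 0‖ ^ 2 : ℝ)) ∧
      ∀ ζ ∈ unitDisk, u ζ * (1 + conj (deriv u 0) * y ζ) = ζ * (deriv u 0 + y ζ) := by
  have hz : (0 : ℂ) ∈ unitDisk := mem_unitDisk.2 (by simp)
  have hnhds := isOpen_unitDisk.mem_nhds hz
  set m := dslope u 0 with hm_def
  have hm : DifferentiableOn ℂ m unitDisk := (Complex.differentiableOn_dslope hnhds).2 hu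
  have hm0 : m 0 = deriv u 0 := dslope_same u 0
  have hmul : ∀ z, u z = z * m z := fun z => by
    simpa [h0] using (sub_smul_dslope u 0 z).symm
  have hmaps' : MapsTo u (ball 0 1) (closedBall (u 0) 1) := by
    rw [h0]; exact hmaps.mono_right ball_subset_closedBall
  -- if `m` had modulus `1` somewhere, then `u` would be a rotation
  have hmlt : ∀ z ∈ unitDisk, ‖m z‖ < 1 := by
    intro z hz
    have hle : ‖m z‖ ≤ 1 := by
      simpa using Complex.norm_dslope_le_div_of_mapsTo_ball hu hmaps' hz
    refine lt_of_le_of_ne hle fun heq => ?_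
    have haff := Complex.affine_of_mapsTo_ball_of_norm_dslope_eq_div hu hmaps' hz
      (by simpa using heq)
    have hder : HasDerivAt u (m z) 0 := by
      refine HasDerivAt.congr_of_eventuallyEq (f := fun w => w * m z)
        (by simpa using (hasDerivAt_id (0 : ℂ)).mul_const (m z)) ?_
      filter_upwards [hnhds] with w hw
      simpa [h0] using haff hw
    rw [hder.deriv, heq] at h1
    exact lt_irrefl _ h1
  have hc' : ‖-deriv u 0‖ < 1 := by simpa using h1
  have hP := preservesPoincare_diskMobius hc'
  have hmt : MapsTo m unitDisk unitDisk := fun z hz => mem_unitDisk.2 (hmlt z hz)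
  have hne : ((1 - ‖deriv u 0‖ ^ 2 : ℝ) : ℂ) ≠ 0 :=
    Complex.ofReal_ne_zero.2 (sq_norm_lt_one h1).ne'
  refine ⟨fun z => diskMobius (-deriv u 0) (m z), hP.differentiableOn.comp hm hmt,
    hP.mapsTo.comp hmt, by simp only [hm0, diskMobius_neg_self], ?_, fun ζ hζ => ?_⟩
  · have hd := HasDerivAt.comp (0 : ℂ) (hasDerivAt_diskMobius hc' (hmlt 0 hz))
      (hm.differentiableAt hnhds).hasDerivAt
    have hden : 1 + conj (-deriv u 0) * m 0 = ((1 - ‖deriv u 0‖ ^ 2 : ℝ) : ℂ) := by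
      rw [hm0, map_neg, neg_mul, Complex.conj_mul']
      push_cast
      ring
    rw [hden, norm_neg] at hd
    refine hd.deriv.trans ?_
    rw [deriv_deriv_zero_eq_dslope hu h0, ← hm_def]
    field_simp
  · have hback := diskMobius_diskMobius_neg h1 (hmlt ζ hζ)
    rw [diskMobius, div_eq_iff (one_add_conj_mul_ne_zero h1.le
      (norm_diskMobius_lt_one hc' (hmlt ζ hζ)))] at hback
    simp only
    rw [hmul ζ, mul_assoc, ← hback]
    ring

/-- The second-order Schwarz lemma. -/
theorem norm_deriv_deriv_zero_le {u : ℂ → ℂ} (hu : DifferentiableOn ℂ u unitDisk)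
    (hmaps : MapsTo u unitDisk unitDisk) (h0 : u 0 = 0) (h1 : ‖deriv u 0‖ < 1) :
    ‖deriv (deriv u) 0‖ ≤ 2 * (1 - ‖deriv u 0‖ ^ 2) := by
  obtain ⟨y, hyd, hym, hy0, hy1, -⟩ := exists_schwarz_quotient hu hmaps h0 h1
  have h := norm_deriv_zero_le_one hyd hym hy0
  have hpos := sq_norm_lt_one h1
  rw [hy1, norm_div, norm_mul, Complex.norm_real, Real.norm_of_nonneg hpos.le,
    div_le_one (by simpa using hpos)] at h
  simpa using h

/-- The equality case of the second-order Schwarz lemma: the map is a Blaschke product of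
degree two, determined by its first two derivatives at `0`. -/
theorem eq_of_norm_deriv_deriv_zero_eq {u : ℂ → ℂ} (hu : DifferentiableOn ℂ u unitDisk)
    (hmaps : MapsTo u unitDisk unitDisk) (h0 : u 0 = 0) (h1 : ‖deriv u 0‖ < 1) {k : ℂ}
    (hk : ‖k‖ = 1) (h2 : deriv (deriv u) 0 = 2 * (1 - ‖deriv u 0‖ ^ 2 : ℝ) * k) {ζ : ℂ}
    (hζ : ζ ∈ unitDisk) :
    u ζ * (1 + conj (deriv u 0) * (k * ζ)) = ζ * (deriv u 0 + k * ζ) := by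
  obtain ⟨y, hyd, hym, hy0, hy1, hy⟩ := exists_schwarz_quotient hu hmaps h0 h1
  have hne : ((1 - ‖deriv u 0‖ ^ 2 : ℝ) : ℂ) ≠ 0 :=
    Complex.ofReal_ne_zero.2 (sq_norm_lt_one h1).ne'
  have hy2 : deriv y 0 = k := by
    rw [hy1, h2]
    field_simp
  rw [← hy2, ← eq_mul_of_norm_deriv_eq_one hyd hym hy0 (by rw [hy2, hk]) hζ]
  exact hy ζ hζ

/-! ### Averaging over rotations -/

/-- Averaging `‖F‖²` over the four rotations `z ↦ iᵏ z` removes every second-order Taylor term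
except the mixed one: what remains to second order is `‖F 0‖² + ‖F' 0‖² r²`. -/
theorem tendsto_sum_sq_norm_rotations {F : ℂ → ℂ} (hF : ∀ᶠ z in 𝓝 0, DifferentiableAt ℂ F z) :
    Tendsto (fun r : ℝ => (‖F r‖ ^ 2 + ‖F (Complex.I * r)‖ ^ 2 + ‖F (-r)‖ ^ 2 +
      ‖F (-(Complex.I * r))‖ ^ 2 - 4 * ‖F 0‖ ^ 2) / r ^ 2) (𝓝[≠] 0)
      (𝓝 (4 * ‖deriv F 0‖ ^ 2)) := by
  obtain ⟨s, hs, hFs⟩ : ∃ s ∈ 𝓝 (0 : ℂ), DifferentiableOn ℂ F s :=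
    ⟨_, hF, fun z hz => DifferentiableAt.differentiableWithinAt hz⟩
  set K := dslope F 0 with hK
  have hKd : DifferentiableAt ℂ K 0 :=
    ((Complex.differentiableOn_dslope hs).2 hFs).differentiableAt hs
  set G := dslope K 0 with hG
  have hGc : ContinuousAt G 0 := continuousAt_dslope_same.2 hKd
  have hKc := hKd.continuousAt
  have key : ∀ z : ℂ, ‖F z‖ ^ 2 = ‖F 0‖ ^ 2 + 2 * (conj (F 0) * (z * K 0 + z ^ 2 * G z)).re +
      ‖z‖ ^ 2 * ‖K z‖ ^ 2 := by
    intro z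
    have h1 : F z = F 0 + z * K z := by
      have := sub_smul_dslope F 0 z
      rw [sub_zero, smul_eq_mul, ← hK] at this
      rw [this]; ring
    have h2 : K z = K 0 + z * G z := by
      have := sub_smul_dslope K 0 z
      rw [sub_zero, smul_eq_mul, ← hG] at this
      rw [this]; ring
    have h3 : z * K 0 + z ^ 2 * G z = z * K z := by rw [h2]; ring
    rw [h3, h1]
    simp only [← Complex.normSq_eq_norm_sq]
    rw [Complex.normSq_add, Complex.normSq_mul, ← Complex.conj_re (F 0 * _)]
    simp only [map_mul, Complex.conj_conj]
    ring
  have hlim : Tendsto (fun r : ℝ => 2 * (conj (F 0) * (G r - G (Complex.I * r) + G (-r) -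
      G (-(Complex.I * r)))).re + (‖K r‖ ^ 2 + ‖K (Complex.I * r)‖ ^ 2 + ‖K (-r)‖ ^ 2 +
      ‖K (-(Complex.I * r))‖ ^ 2)) (𝓝 0) (𝓝 (2 * (conj (F 0) * (G 0 - G 0 + G 0 - G 0)).re +
      (‖K 0‖ ^ 2 + ‖K 0‖ ^ 2 + ‖K 0‖ ^ 2 + ‖K 0‖ ^ 2))) := by
    have hpath : ∀ {H : ℂ → ℂ} (c : ℂ), ContinuousAt H 0 →
        Tendsto (fun r : ℝ => H (c * r)) (𝓝 0) (𝓝 (H 0)) := by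
      intro H c hH
      refine hH.tendsto.comp ?_
      have : Continuous fun r : ℝ => c * (r : ℂ) := by fun_prop
      simpa using this.tendsto 0
    have g1 := by simpa using hpath 1 hGc
    have g3 := by simpa using hpath (-1) hGc
    have g2 := hpath Complex.I hGc
    have g4 := by simpa using hpath (-Complex.I) hGc
    have k1 := by simpa using hpath 1 hKc
    have k3 := by simpa using hpath (-1) hKc
    have k2 := hpath Complex.I hKc
    have k4 := by simpa using hpath (-Complex.I) hKc
    refine Tendsto.add (Tendsto.const_mul _ ?_)
      ((((k1.norm.pow 2).add (k2.norm.pow 2)).add (k3.norm.pow 2)).add (k4.norm.pow 2))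
    exact (Complex.continuous_re.tendsto _).comp ((((g1.sub g2).add g3).sub g4).const_mul _)
  have hval : 2 * (conj (F 0) * (G 0 - G 0 + G 0 - G 0)).re +
      (‖K 0‖ ^ 2 + ‖K 0‖ ^ 2 + ‖K 0‖ ^ 2 + ‖K 0‖ ^ 2) = 4 * ‖deriv F 0‖ ^ 2 := by
    rw [hK, dslope_same]
    simp
    ring
  rw [hval] at hlim
  refine (hlim.mono_left nhdsWithin_le_nhds).congr' ?_
  filter_upwards [self_mem_nhdsWithin] with r hr
  have hr0 : r ≠ 0 := hr
  rw [key r, key (Complex.I * r), key (-r), key (-(Complex.I * r)), eq_div_iff (by positivity)]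
  have e1 : (Complex.I * (r : ℂ)) ^ 2 = -(r : ℂ) ^ 2 := by rw [mul_pow, Complex.I_sq]; ring
  rw [neg_sq, neg_sq, e1]
  simp only [norm_neg, norm_mul, Complex.norm_I, Complex.norm_real, Real.norm_eq_abs, one_mul,
    sq_abs, ← Complex.ofReal_pow, ← Complex.ofReal_neg]
  simp only [Complex.mul_re, Complex.mul_im, Complex.add_re, Complex.add_im, Complex.sub_re,
    Complex.sub_im, Complex.neg_re, Complex.neg_im, Complex.ofReal_re, Complex.ofReal_im,
    Complex.I_re, Complex.I_im]
  ring

/-! ### Slices of functions in normal form -/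

lemma zero_mem_unitDisk : (0 : ℂ) ∈ unitDisk := mem_unitDisk.2 (by simp)

lemma zero_mem_bidisk : ((0, 0) : ℂ × ℂ) ∈ bidisk := ⟨zero_mem_unitDisk, zero_mem_unitDisk⟩

lemma unitDisk_mem_nhds_zero : unitDisk ∈ 𝓝 (0 : ℂ) := isOpen_unitDisk.mem_nhds zero_mem_unitDisk

lemma mk_mul_mem_bidisk {β ζ : ℂ} (hβ : ‖β‖ = 1) (hζ : ζ ∈ unitDisk) : (ζ, β * ζ) ∈ bidisk := by
  simpa [mem_bidisk, hβ] using mem_unitDisk.1 hζ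

lemma hasDerivAt_slice {g : ℂ × ℂ → ℂ} (hg : DifferentiableOn ℂ g bidisk) {β ζ : ℂ}
    (hβ : ‖β‖ = 1) (hζ : ζ ∈ unitDisk) :
    HasDerivAt (fun ζ => g (ζ, β * ζ))
      (partialFst g (ζ, β * ζ) + β * partialSnd g (ζ, β * ζ)) ζ := by
  have := hasDerivAt_comp_prodMk (f := g) (g := fun ζ => ζ) (h := fun ζ => β * ζ)
    (hg.differentiableAt (isOpen_bidisk.mem_nhds (mk_mul_mem_bidisk hβ hζ)))
    (hasDerivAt_id ζ) ((hasDerivAt_id ζ).const_mul β)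
  simpa using this

lemma hasDerivAt_slice_zero {g : ℂ × ℂ → ℂ} (hg : DifferentiableOn ℂ g bidisk) {β : ℂ}
    (hβ : ‖β‖ = 1) :
    HasDerivAt (fun ζ => g (ζ, β * ζ)) (partialFst g (0, 0) + β * partialSnd g (0, 0)) 0 := by
  simpa using hasDerivAt_slice hg hβ zero_mem_unitDisk

lemma differentiableOn_slice {g : ℂ × ℂ → ℂ} (hg : DifferentiableOn ℂ g bidisk) {β : ℂ}
    (hβ : ‖β‖ = 1) : DifferentiableOn ℂ (fun ζ => g (ζ, β * ζ)) unitDisk := fun _ hζ =>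
  (hasDerivAt_slice hg hβ hζ).differentiableAt.differentiableWithinAt

lemma deriv_deriv_slice {f : ℂ × ℂ → ℂ} (hf : DifferentiableOn ℂ f bidisk) {β : ℂ}
    (hβ : ‖β‖ = 1) : deriv (deriv fun ζ => f (ζ, β * ζ)) 0 =
      partialFst (partialFst f) (0, 0) + 2 * β * partialSnd (partialFst f) (0, 0) +
        β ^ 2 * partialSnd (partialSnd f) (0, 0) := by
  have h1 := (hasDerivAt_slice_zero (differentiableOn_partialFst hf) hβ).add
    ((hasDerivAt_slice_zero (differentiableOn_partialSnd hf) hβ).const_mul β)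
  have h2 := h1.congr_of_eventuallyEq (f₁ := deriv fun ζ => f (ζ, β * ζ))
    (Filter.eventually_of_mem unitDisk_mem_nhds_zero fun ζ hζ => (hasDerivAt_slice hf hβ hζ).deriv)
  rw [h2.deriv, ← partialSnd_partialFst_eq hf zero_mem_bidisk]
  ring

lemma one_sub_sq_norm_add_mul {a b : ℝ} (hab : a + b = 1) {β : ℂ} (hβ : ‖β‖ = 1) :
    1 - ‖(a + β * b : ℂ)‖ ^ 2 = a * b * ‖1 - β‖ ^ 2 := by
  have h1 : β.re * β.re + β.im * β.im = 1 := by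
    rw [← Complex.normSq_apply, Complex.normSq_eq_norm_sq, hβ, one_pow]
  obtain rfl : b = 1 - a := by linarith
  simp only [← Complex.normSq_eq_norm_sq, Complex.normSq_apply, Complex.add_re, Complex.add_im,
    Complex.mul_re, Complex.mul_im, Complex.sub_re, Complex.sub_im, Complex.ofReal_re,
    Complex.ofReal_im, Complex.one_re, Complex.one_im]
  linear_combination (a - 1) * h1

lemma norm_add_mul_lt_one {a b : ℝ} (ha : 0 < a) (hb : 0 < b) (hab : a + b = 1) {β : ℂ}
    (hβ : ‖β‖ = 1) (hβ1 : β ≠ 1) : ‖(a + β * b : ℂ)‖ < 1 := by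
  have h1 := one_sub_sq_norm_add_mul hab hβ
  have h2 : 0 < ‖1 - β‖ := norm_pos_iff.2 (sub_ne_zero.2 hβ1.symm)
  have h3 : 0 < a * b * ‖1 - β‖ ^ 2 := by positivity
  nlinarith [norm_nonneg (a + β * b : ℂ)]

/-- `f` is a holomorphic map of the bidisk to the disk fixing the origin, whose partial
derivatives there are nonnegative and add up to `1`. -/
structure IsNormalizedExtremal (f : ℂ × ℂ → ℂ) (a b : ℝ) : Prop where
  holo : IsHolomorphicBidiskToDisk f
  map_zero : f (0, 0) = 0
  partialFst_zero : partialFst f (0, 0) = a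
  partialSnd_zero : partialSnd f (0, 0) = b
  nonneg_left : 0 ≤ a
  nonneg_right : 0 ≤ b
  add_eq_one : a + b = 1

namespace IsNormalizedExtremal

variable {f : ℂ × ℂ → ℂ} {a b : ℝ}

lemma mapsTo_slice (h : IsNormalizedExtremal f a b) {β : ℂ} (hβ : ‖β‖ = 1) :
    MapsTo (fun ζ => f (ζ, β * ζ)) unitDisk unitDisk := fun _ hζ =>
  h.holo.2 (mk_mul_mem_bidisk hβ hζ)

lemma slice_zero (h : IsNormalizedExtremal f a b) (β : ℂ) : f (0, β * 0) = 0 := by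
  rw [mul_zero, h.map_zero]

lemma deriv_slice_zero (h : IsNormalizedExtremal f a b) {β : ℂ} (hβ : ‖β‖ = 1) :
    deriv (fun ζ => f (ζ, β * ζ)) 0 = a + β * b := by
  rw [(hasDerivAt_slice_zero h.holo.1 hβ).deriv, h.partialFst_zero, h.partialSnd_zero]

lemma slice_eq_of_norm_eq_one (h : IsNormalizedExtremal f a b) {β : ℂ} (hβ : ‖β‖ = 1)
    (h1 : ‖(a + β * b : ℂ)‖ = 1) {ζ : ℂ} (hζ : ζ ∈ unitDisk) :
    f (ζ, β * ζ) = (a + β * b) * ζ := by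
  have := eq_mul_of_norm_deriv_eq_one (differentiableOn_slice h.holo.1 hβ) (h.mapsTo_slice hβ)
    (h.slice_zero β) (by rw [h.deriv_slice_zero hβ, h1]) hζ
  rwa [h.deriv_slice_zero hβ] at this

lemma slice_one (h : IsNormalizedExtremal f a b) {ζ : ℂ} (hζ : ζ ∈ unitDisk) :
    f (ζ, 1 * ζ) = ζ := by
  have hab : (a + 1 * b : ℂ) = 1 := by
    rw [one_mul, ← Complex.ofReal_add, h.add_eq_one, Complex.ofReal_one]
  have h1 := h.slice_eq_of_norm_eq_one (β := 1) (by simp) (by rw [hab, norm_one]) hζ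
  rw [hab] at h1
  exact h1.trans (one_mul ζ)

/-- The second-order Taylor polynomial of a function in normal form is a multiple of
`(z - w)²`. -/
theorem hessian (h : IsNormalizedExtremal f a b) (ha : 0 < a) (hb : 0 < b) :
    partialSnd (partialFst f) (0, 0) = -partialFst (partialFst f) (0, 0) ∧
      partialSnd (partialSnd f) (0, 0) = partialFst (partialFst f) (0, 0) := by
  set A := partialFst (partialFst f) (0, 0) with hA
  set B := partialSnd (partialFst f) (0, 0) with hB
  set C := partialSnd (partialSnd f) (0, 0) with hC
  have hone : A + 2 * B + C = 0 := by
    have h1 := deriv_deriv_slice h.holo.1 (β := 1) (by simp)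
    have h2 : deriv (fun ζ => f (ζ, 1 * ζ)) =ᶠ[𝓝 0] fun _ => 1 := by
      filter_upwards [unitDisk_mem_nhds_zero] with ζ hζ
      refine ((hasDerivAt_id ζ).congr_of_eventuallyEq ?_).deriv
      filter_upwards [isOpen_unitDisk.mem_nhds hζ] with z hz using h.slice_one hz
    rw [h2.deriv_eq, deriv_const] at h1
    rw [← hA, ← hB, ← hC] at h1
    linear_combination -h1
  -- dividing the second-order Schwarz bound on the slices by `β - 1`
  have hbound : ∀ β : ℂ, ‖β‖ = 1 → β ≠ 1 → ‖C * (β + 1) + 2 * B‖ ≤ 2 * (a * b) * ‖1 - β‖ := by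
    intro β hβ hβ1
    have hlt := norm_add_mul_lt_one ha hb h.add_eq_one hβ hβ1
    have h1 := norm_deriv_deriv_zero_le (differentiableOn_slice h.holo.1 hβ) (h.mapsTo_slice hβ)
      (h.slice_zero β) (by rwa [h.deriv_slice_zero hβ])
    rw [h.deriv_slice_zero hβ, deriv_deriv_slice h.holo.1 hβ, ← hA, ← hB, ← hC,
      one_sub_sq_norm_add_mul h.add_eq_one hβ] at h1
    have h2 : A + 2 * β * B + β ^ 2 * C = -((1 - β) * (C * (β + 1) + 2 * B)) := by
      linear_combination hone
    rw [h2, norm_neg, norm_mul] at h1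
    have h3 : 0 < ‖1 - β‖ := norm_pos_iff.2 (sub_ne_zero.2 hβ1.symm)
    refine le_of_mul_le_mul_left ?_ h3
    linarith
  have hlim : ‖C * (1 + 1) + 2 * B‖ ≤ 2 * (a * b) * ‖(1 - 1 : ℂ)‖ := by
    have hexp : Tendsto (fun θ : ℝ => Complex.exp (θ * Complex.I)) (𝓝[>] 0) (𝓝 1) := by
      have : Continuous fun θ : ℝ => Complex.exp (θ * Complex.I) := by fun_prop
      simpa using (this.tendsto 0).mono_left nhdsWithin_le_nhds
    refine le_of_tendsto_of_tendsto
      (((hexp.add_const 1).const_mul C).add_const (2 * B)).norm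
      ((hexp.const_sub 1).norm.const_mul (2 * (a * b))) ?_
    filter_upwards [Ioo_mem_nhdsGT Real.pi_pos] with θ hθ
    refine hbound _ (Complex.norm_exp_ofReal_mul_I θ) fun h1 => ?_
    have h2 := congrArg Complex.im h1
    rw [Complex.exp_ofReal_mul_I_im, Complex.one_im] at h2
    exact (Real.sin_pos_of_pos_of_lt_pi hθ.1 hθ.2).ne' h2
  have h0 : C * (1 + 1) + 2 * B = 0 := by
    rw [← norm_le_zero_iff]
    simpa using hlim
  constructor
  · linear_combination hone - h0 / 2
  · linear_combination h0 - hone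

end IsNormalizedExtremal

/-! ### The size of the second derivative on an extremal disk -/

/-- A holomorphic function with positive value at `0` has a holomorphic square root nearby. -/
lemma exists_sqrt {G : ℂ → ℂ} (hG : ∀ᶠ z in 𝓝 0, DifferentiableAt ℂ G z) {a : ℝ} (ha : 0 < a)
    (hGa : G 0 = a) : ∃ P : ℂ → ℂ, (∀ᶠ z in 𝓝 0, DifferentiableAt ℂ P z) ∧
      (∀ᶠ z in 𝓝 0, ‖P z‖ ^ 2 = ‖G z‖) ∧ ‖deriv P 0‖ ^ 2 = ‖deriv G 0‖ ^ 2 / (4 * a) := by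
  have hslit : ∀ᶠ z in 𝓝 0, G z ∈ Complex.slitPlane :=
    hG.self_of_nhds.continuousAt.eventually_mem
      (Complex.isOpen_slitPlane.mem_nhds (by rw [hGa]; exact Complex.ofReal_mem_slitPlane.2 ha))
  set P : ℂ → ℂ := fun z => Complex.exp (Complex.log (G z) / 2) with hP
  have hPd : ∀ᶠ z in 𝓝 0, DifferentiableAt ℂ P z := by
    filter_upwards [hG, hslit] with z h1 h2
    exact ((h1.clog h2).div_const 2).cexp
  have hsq : ∀ᶠ z in 𝓝 0, P z ^ 2 = G z := by
    filter_upwards [hslit] with z h2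
    rw [hP, ← Complex.exp_nat_mul]
    push_cast
    rw [mul_div_cancel₀ _ two_ne_zero, Complex.exp_log (Complex.slitPlane_ne_zero h2)]
  have hnorm : ∀ᶠ z in 𝓝 0, ‖P z‖ ^ 2 = ‖G z‖ := hsq.mono fun z hz => by rw [← hz, norm_pow]
  refine ⟨P, hPd, hnorm, ?_⟩
  have h1 := ((hPd.self_of_nhds.hasDerivAt.pow 2).congr_of_eventuallyEq
    (hsq.mono fun z hz => hz.symm)).deriv
  have h2 := hnorm.self_of_nhds
  rw [hGa, Complex.norm_real, Real.norm_of_nonneg ha.le] at h2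
  rw [h1]
  simp only [norm_mul, norm_pow, mul_pow]
  simp
  rw [h2]
  field_simp
  norm_num

/-- Comparing the coefficients of `z z̄` in an identity between sums of squared moduli. -/
lemma sum_sq_norm_deriv_eq {P Q u R T : ℂ → ℂ} {c : ℝ}
    (hP : ∀ᶠ z in 𝓝 0, DifferentiableAt ℂ P z) (hQ : ∀ᶠ z in 𝓝 0, DifferentiableAt ℂ Q z)
    (hu : ∀ᶠ z in 𝓝 0, DifferentiableAt ℂ u z) (hR : ∀ᶠ z in 𝓝 0, DifferentiableAt ℂ R z)
    (hT : ∀ᶠ z in 𝓝 0, DifferentiableAt ℂ T z)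
    (h : ∀ᶠ z in 𝓝 0, ‖P z‖ ^ 2 + ‖Q z‖ ^ 2 + ‖u z‖ ^ 2 = c + ‖R z‖ ^ 2 + ‖T z‖ ^ 2) :
    ‖deriv P 0‖ ^ 2 + ‖deriv Q 0‖ ^ 2 + ‖deriv u 0‖ ^ 2 =
      ‖deriv R 0‖ ^ 2 + ‖deriv T 0‖ ^ 2 := by
  have h1 := ((tendsto_sum_sq_norm_rotations hP).add (tendsto_sum_sq_norm_rotations hQ)).add
    (tendsto_sum_sq_norm_rotations hu)
  have h2 := (tendsto_sum_sq_norm_rotations hR).add (tendsto_sum_sq_norm_rotations hT)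
  have hpath : ∀ d : ℂ, ∀ᶠ r : ℝ in 𝓝[≠] 0, ‖P (d * r)‖ ^ 2 + ‖Q (d * r)‖ ^ 2 + ‖u (d * r)‖ ^ 2 =
      c + ‖R (d * r)‖ ^ 2 + ‖T (d * r)‖ ^ 2 := by
    intro d
    have hc : Continuous fun r : ℝ => d * (r : ℂ) := by fun_prop
    have ht : Tendsto (fun r : ℝ => d * (r : ℂ)) (𝓝 0) (𝓝 0) := by simpa using hc.tendsto 0
    exact (ht.mono_left nhdsWithin_le_nhds).eventually h
  have h0 := h.self_of_nhds
  have h3 := tendsto_nhds_unique (h1.congr' ?_) h2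
  · linarith
  filter_upwards [hpath 1, hpath Complex.I, hpath (-1), hpath (-Complex.I)] with r e1 e2 e3 e4
  simp only [one_mul, neg_mul] at e1 e2 e3 e4
  rw [← add_div, ← add_div, ← add_div]
  congr 1
  linear_combination e1 + e2 + e3 + e4 - 4 * h0

/-- A second disk `{(ζ, β ζ)}` in the extreme set forces `‖∂²f/∂z²‖` to attain the largest value
that the second-order Schwarz lemma allows. -/
theorem IsNormalizedExtremal.norm_partialFst_partialFst {f : ℂ × ℂ → ℂ} {a b : ℝ}
    (h : IsNormalizedExtremal f a b) (ha : 0 < a) (hb : 0 < b) {β : ℂ} (hβ : ‖β‖ = 1)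
    (hβ1 : β ≠ 1) (hX : ∀ ζ ∈ unitDisk, SchwarzPickEqualityAt f (ζ, β * ζ)) :
    ‖partialFst (partialFst f) (0, 0)‖ = 2 * (a * b) := by
  obtain ⟨hB, hC⟩ := h.hessian ha hb
  set A := partialFst (partialFst f) (0, 0) with hA
  have hev : ∀ {u : ℂ → ℂ}, DifferentiableOn ℂ u unitDisk →
      ∀ᶠ z in 𝓝 0, DifferentiableAt ℂ u z := fun hu =>
    Filter.eventually_of_mem unitDisk_mem_nhds_zero fun z hz =>
      hu.differentiableAt (isOpen_unitDisk.mem_nhds hz)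
  have hu := hev (differentiableOn_slice h.holo.1 hβ)
  have hGd := differentiableOn_partialFst h.holo.1
  have hHd := differentiableOn_partialSnd h.holo.1
  have hG' := (hasDerivAt_slice_zero hGd hβ).deriv
  have hH' := (hasDerivAt_slice_zero hHd hβ).deriv
  rw [← hA, hB] at hG'
  rw [← partialSnd_partialFst_eq h.holo.1 zero_mem_bidisk, hB, hC] at hH'
  obtain ⟨P, hPd, hPn, hP'⟩ := exists_sqrt (hev (differentiableOn_slice hGd hβ)) ha
    (by rw [mul_zero, h.partialFst_zero])
  obtain ⟨Q, hQd, hQn, hQ'⟩ := exists_sqrt (hev (differentiableOn_slice hHd hβ)) hb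
    (by rw [mul_zero, h.partialSnd_zero])
  have hmul : ∀ {P : ℂ → ℂ}, (∀ᶠ z in 𝓝 0, DifferentiableAt ℂ P z) →
      (∀ᶠ z in 𝓝 0, DifferentiableAt ℂ (fun z => z * P z) z) ∧
        deriv (fun z => z * P z) 0 = P 0 := by
    intro P hP
    refine ⟨hP.mono fun z hz => differentiableAt_id.mul hz, ?_⟩
    have := ((hasDerivAt_id (0 : ℂ)).mul hP.self_of_nhds.hasDerivAt).deriv
    rw [id, one_mul, zero_mul, add_zero] at this
    exact this
  -- extremality reads `‖P‖² + ‖Q‖² + ‖u‖² = 1 + ‖ζ P‖² + ‖ζ Q‖²`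
  have hid := sum_sq_norm_deriv_eq (c := 1) hPd hQd hu (hmul hPd).1 (hmul hQd).1 (by
    filter_upwards [hPn, hQn, unitDisk_mem_nhds_zero] with ζ h1 h2 h3
    have h4 := hX ζ h3
    simp only [SchwarzPickEqualityAt, norm_mul, hβ, one_mul] at h4
    simp only [norm_mul, mul_pow, h1, h2]
    linear_combination h4)
  have hP0 := hPn.self_of_nhds
  have hQ0 := hQn.self_of_nhds
  rw [mul_zero, h.partialFst_zero, Complex.norm_real, Real.norm_of_nonneg ha.le] at hP0
  rw [mul_zero, h.partialSnd_zero, Complex.norm_real, Real.norm_of_nonneg hb.le] at hQ0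
  rw [(hmul hPd).2, (hmul hQd).2, hP', hQ', hP0, hQ0, h.add_eq_one, h.deriv_slice_zero hβ,
    hG', hH'] at hid
  have e1 : A + β * -A = A * (1 - β) := by ring
  have e2 : -A + β * A = -(A * (1 - β)) := by ring
  rw [e1, e2, norm_neg, norm_mul] at hid
  have h5 := one_sub_sq_norm_add_mul h.add_eq_one hβ
  have h6 : 0 < ‖1 - β‖ := norm_pos_iff.2 (sub_ne_zero.2 hβ1.symm)
  have h7 : (‖A‖ * ‖1 - β‖) ^ 2 / (4 * a) + (‖A‖ * ‖1 - β‖) ^ 2 / (4 * b) =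
      a * b * ‖1 - β‖ ^ 2 := by linarith
  have h8 : (‖A‖ * ‖1 - β‖) ^ 2 / (4 * a) + (‖A‖ * ‖1 - β‖) ^ 2 / (4 * b) =
      (‖A‖ * ‖1 - β‖) ^ 2 * (a + b) / (4 * (a * b)) := by
    field_simp
    ring
  rw [h8, h.add_eq_one, mul_one, div_eq_iff (by positivity), mul_pow] at h7
  have h9 : ‖A‖ ^ 2 = (2 * (a * b)) ^ 2 := by
    apply mul_right_cancel₀ (pow_ne_zero 2 h6.ne')
    linear_combination h7
  exact (pow_left_inj₀ (norm_nonneg A) (by positivity) two_ne_zero).1 h9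

/-! ### The rational function determined by the slices -/

/-- A function in normal form with a second disk in its extreme set agrees with
`(a z + b w - κ z w) / (1 - κ (b z + a w))` where `‖z‖ = ‖w‖`. -/
theorem IsNormalizedExtremal.exists_slice_eq {f : ℂ × ℂ → ℂ} {a b : ℝ}
    (h : IsNormalizedExtremal f a b) {β₀ : ℂ} (hβ₀ : ‖β₀‖ = 1) (hβ₀1 : β₀ ≠ 1)
    (hX : ∀ ζ ∈ unitDisk, SchwarzPickEqualityAt f (ζ, β₀ * ζ)) :
    ∃ κ : ℂ, ‖κ‖ = 1 ∧ ∀ β : ℂ, ‖β‖ = 1 → ∀ ζ ∈ unitDisk,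
      f (ζ, β * ζ) * (1 - (b * ζ + a * (β * ζ)) * κ) =
        a * ζ + b * (β * ζ) - ζ * (β * ζ) * κ := by
  rcases h.nonneg_left.eq_or_lt with ha | ha
  · have hb : b = 1 := by linarith [h.add_eq_one]
    refine ⟨1, norm_one, fun β hβ ζ hζ => ?_⟩
    rw [h.slice_eq_of_norm_eq_one hβ (by simp [← ha, hb, hβ]) hζ, ← ha, hb]
    push_cast
    ring
  rcases h.nonneg_right.eq_or_lt with hb | hb
  · have ha : a = 1 := by linarith [h.add_eq_one]
    refine ⟨1, norm_one, fun β hβ ζ hζ => ?_⟩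
    rw [h.slice_eq_of_norm_eq_one hβ (by simp [← hb, ha]) hζ, ← hb, ha]
    push_cast
    ring
  obtain ⟨hB, hC⟩ := h.hessian ha hb
  have hA := h.norm_partialFst_partialFst ha hb hβ₀ hβ₀1 hX
  set A := partialFst (partialFst f) (0, 0) with hA_def
  have hab : (0 : ℝ) < 2 * (a * b) := by positivity
  have hab0 : (2 * (a * b) : ℂ) ≠ 0 := by exact_mod_cast hab.ne'
  have habc : (a + b : ℂ) = 1 := by exact_mod_cast h.add_eq_one
  obtain ⟨κ, hκ⟩ : ∃ κ : ℂ, A = 2 * (a * b) * κ := ⟨A / (2 * (a * b)), (mul_div_cancel₀ _ hab0).symm⟩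
  have hκ1 : ‖κ‖ = 1 := by
    rw [hκ, norm_mul] at hA
    have h1 : ‖(2 * (a * b) : ℂ)‖ = 2 * (a * b) := by
      have : (2 * (a * b) : ℂ) = ((2 * (a * b) : ℝ) : ℂ) := by push_cast; rfl
      rw [this, Complex.norm_real, Real.norm_of_nonneg hab.le]
    rw [h1] at hA
    exact mul_left_cancel₀ hab.ne' (hA.trans (mul_one _).symm)
  refine ⟨κ, hκ1, fun β hβ ζ hζ => ?_⟩
  rcases eq_or_ne β 1 with rfl | hβ1
  · rw [h.slice_one hζ]
    linear_combination (-ζ - ζ ^ 2 * κ) * habc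
  have hββ : β * conj β = 1 := by rw [Complex.mul_conj', hβ]; simp
  have hlt := norm_add_mul_lt_one ha hb h.add_eq_one hβ hβ1
  -- `(1 - β)² = -β ‖1 - β‖²` on the unit circle, so equality holds on every slice
  have h1 := eq_of_norm_deriv_deriv_zero_eq (differentiableOn_slice h.holo.1 hβ)
    (h.mapsTo_slice hβ) (h.slice_zero β) (by rwa [h.deriv_slice_zero hβ]) (k := -(β * κ))
    (by simp [hβ, hκ1]) (by
      rw [deriv_deriv_slice h.holo.1 hβ, ← hA_def, hB, hC, h.deriv_slice_zero hβ,
        one_sub_sq_norm_add_mul h.add_eq_one hβ, hκ]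
      push_cast
      rw [← Complex.mul_conj', map_sub, map_one]
      linear_combination (2 * (a * b) * κ * (β - 1)) * hββ) hζ
  rw [h.deriv_slice_zero hβ] at h1
  simp only [map_add, map_mul, Complex.conj_ofReal] at h1
  linear_combination h1 + f (ζ, β * ζ) * b * κ * ζ * hββ

/-- A holomorphic function on the bidisk vanishing on `{‖z‖ = ‖w‖}` vanishes identically. -/
theorem eq_zero_of_eq_zero_on_slices {E : ℂ × ℂ → ℂ} (hE : DifferentiableOn ℂ E bidisk)
    (h0 : ∀ β : ℂ, ‖β‖ = 1 → ∀ ζ ∈ unitDisk, E (ζ, β * ζ) = 0) {p : ℂ × ℂ} (hp : p ∈ bidisk) :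
    E p = 0 := by
  obtain ⟨z, w⟩ := p
  obtain ⟨hz, hw⟩ : z ∈ unitDisk ∧ w ∈ unitDisk := hp
  have hmain : ∀ z ∈ unitDisk, z ≠ 0 → E (z, w) = 0 := by
    intro z hz hz0
    have hg : DifferentiableOn ℂ (fun w => E (z, w)) unitDisk :=
      hE.comp (by fun_prop) fun w hw => ⟨hz, hw⟩
    have hzn : 0 < ‖z‖ := norm_pos_iff.2 hz0
    have hsub : closedBall (0 : ℂ) ‖z‖ ⊆ unitDisk := closedBall_subset_ball (mem_unitDisk.1 hz)
    have hball : EqOn (fun w => E (z, w)) (fun _ => 0) (closure (ball 0 ‖z‖)) := by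
      refine Complex.eqOn_closure_of_eqOn_frontier isBounded_ball
        (hg.diffContOnCl_ball hsub) diffContOnCl_const fun w hw => ?_
      rw [frontier_ball _ hzn.ne', mem_sphere_zero_iff_norm] at hw
      -- the point `(z, w)` with `‖w‖ = ‖z‖` lies on the slice of slope `w / z`
      have := h0 (w / z) (by rw [norm_div, hw, div_self hzn.ne']) z hz
      rwa [div_mul_cancel₀ _ hz0] at this
    have hev : (fun w => E (z, w)) =ᶠ[𝓝 0] 0 :=
      Filter.eventually_of_mem (ball_mem_nhds 0 hzn) fun w hw => hball (subset_closure hw)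
    exact (hg.analyticOnNhd isOpen_unitDisk).eqOn_zero_of_preconnected_of_eventuallyEq_zero
      (convex_ball _ _).isPreconnected zero_mem_unitDisk hev hw
  rcases eq_or_ne z 0 with rfl | hz0
  · have hc : ContinuousAt (fun t : ℂ => E (t, w)) 0 :=
      ContinuousAt.comp (f := fun t : ℂ => (t, w))
        (hE.differentiableAt (isOpen_bidisk.mem_nhds ⟨hz, hw⟩)).continuousAt (by fun_prop)
    refine tendsto_nhds_unique (hc.tendsto.mono_left nhdsWithin_le_nhds)
      (tendsto_const_nhds.congr' (f₁ := fun _ => 0) (l₁ := 𝓝[≠] (0 : ℂ)) ?_)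
    filter_upwards [self_mem_nhdsWithin, mem_nhdsWithin_of_mem_nhds unitDisk_mem_nhds_zero]
      with t ht0 ht using (hmain t ht ht0).symm
  · exact hmain z hz hz0

/-- The identity `|D|² - |N|² = (1 - |z|²) a |1 - w|² + (1 - |w|²) b |1 - z|²` for the
denominator `D` and numerator `N` of the extremal rational function. -/
lemma extremal_identity {a b : ℝ} (hab : a + b = 1) (z w : ℂ) :
    (1 - ‖z‖ ^ 2) * (a * ‖1 - w‖ ^ 2) + (1 - ‖w‖ ^ 2) * (b * ‖1 - z‖ ^ 2) =
      ‖1 - (b * z + a * w)‖ ^ 2 - ‖a * z + b * w - z * w‖ ^ 2 := by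
  obtain rfl : b = 1 - a := by linarith
  simp only [← Complex.normSq_eq_norm_sq, Complex.normSq_apply, Complex.add_re, Complex.add_im,
    Complex.mul_re, Complex.mul_im, Complex.sub_re, Complex.sub_im, Complex.ofReal_re,
    Complex.ofReal_im, Complex.one_re, Complex.one_im]
  ring

lemma one_sub_mul_ne_zero {a b : ℝ} (ha : 0 ≤ a) (hb : 0 ≤ b) (hab : a + b = 1) {κ : ℂ}
    (hκ : ‖κ‖ = 1) {p : ℂ × ℂ} (hp : p ∈ bidisk) : 1 - (b * p.1 + a * p.2) * κ ≠ 0 := by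
  obtain ⟨h1, h2⟩ := mem_bidisk.1 hp
  have hle : ‖(b * p.1 + a * p.2 : ℂ)‖ ≤ b * ‖p.1‖ + a * ‖p.2‖ := by
    refine (norm_add_le _ _).trans_eq ?_
    rw [norm_mul, norm_mul, Complex.norm_real, Complex.norm_real, Real.norm_of_nonneg ha,
      Real.norm_of_nonneg hb]
  have hlt : b * ‖p.1‖ + a * ‖p.2‖ < 1 := by
    rcases ha.eq_or_lt with rfl | ha
    · simp_all
    · nlinarith
  intro h0
  have h3 : ‖(b * p.1 + a * p.2) * κ‖ = 1 := by rw [← sub_eq_zero.1 h0, norm_one]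
  rw [norm_mul, hκ, mul_one] at h3
  linarith

/-- The functions `(a z + b w - κ z w) / (1 - κ (b z + a w))` are everywhere extremal: their
partial derivatives are `a (1 - κ w)² / D²` and `b (1 - κ z)² / D²`, with `D` the denominator. -/
theorem everywhere_extremal_of_eq {f : ℂ × ℂ → ℂ} {a b : ℝ} (ha : 0 ≤ a) (hb : 0 ≤ b)
    (hab : a + b = 1) {κ : ℂ} (hκ : ‖κ‖ = 1)
    (hf : ∀ p ∈ bidisk, f p * (1 - (b * p.1 + a * p.2) * κ) = a * p.1 + b * p.2 - p.1 * p.2 * κ) :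
    EverywhereInfinitesimallyExtremal f := by
  rintro ⟨z, w⟩ hp
  obtain ⟨hz, hw⟩ : z ∈ unitDisk ∧ w ∈ unitDisk := hp
  have hden : ∀ p ∈ bidisk, 1 - (b * p.1 + a * p.2) * κ ≠ 0 := fun p hp =>
    one_sub_mul_ne_zero ha hb hab hκ hp
  have hf' : ∀ p ∈ bidisk, f p =
      (a * p.1 + b * p.2 - p.1 * p.2 * κ) / (1 - (b * p.1 + a * p.2) * κ) := fun p hp =>
    (eq_div_iff (hden p hp)).2 (hf p hp)
  have hD := hden (z, w) ⟨hz, hw⟩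
  have hfzw := hf' (z, w) ⟨hz, hw⟩
  simp only at hD hfzw
  set D := 1 - (b * z + a * w) * κ with hD_def
  have hbc : (b : ℂ) = 1 - a := by
    rw [← Complex.ofReal_one, ← Complex.ofReal_sub]
    congr 1
    linarith
  have hid := hasDerivAt_id (𝕜 := ℂ)
  have h1 : partialFst f (z, w) = a * (1 - w * κ) ^ 2 / D ^ 2 := by
    have hN : HasDerivAt (fun ζ : ℂ => a * ζ + b * w - ζ * w * κ) (a * 1 - 1 * w * κ) z :=
      (((hid z).const_mul (a : ℂ)).add_const (b * w : ℂ)).sub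
        (((hid z).mul_const w).mul_const κ)
    have hD' : HasDerivAt (fun ζ : ℂ => 1 - (b * ζ + a * w) * κ) (-(b * 1 * κ)) z :=
      ((((hid z).const_mul (b : ℂ)).add_const (a * w : ℂ)).mul_const κ).const_sub 1
    have h := (hN.div hD' hD).congr_of_eventuallyEq (f₁ := fun ζ => f (ζ, w))
      (Filter.eventually_of_mem (isOpen_unitDisk.mem_nhds hz) fun ζ hζ => hf' (ζ, w) ⟨hζ, hw⟩)
    refine h.deriv.trans ?_
    congr 1
    simp only [hbc]
    ring
  have h2 : partialSnd f (z, w) = b * (1 - z * κ) ^ 2 / D ^ 2 := by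
    have hN : HasDerivAt (fun ζ : ℂ => a * z + b * ζ - z * ζ * κ) (b * 1 - z * 1 * κ) w :=
      (((hid w).const_mul (b : ℂ)).const_add (a * z : ℂ)).sub
        (((hid w).const_mul z).mul_const κ)
    have hD' : HasDerivAt (fun ζ : ℂ => 1 - (b * z + a * ζ) * κ) (-(a * 1 * κ)) w :=
      ((((hid w).const_mul (a : ℂ)).const_add (b * z : ℂ)).mul_const κ).const_sub 1
    have h := (hN.div hD' hD).congr_of_eventuallyEq (f₁ := fun ζ => f (z, ζ))
      (Filter.eventually_of_mem (isOpen_unitDisk.mem_nhds hw) fun ζ hζ => hf' (z, ζ) ⟨hz, hζ⟩)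
    refine h.deriv.trans ?_
    congr 1
    simp only [hbc]
    ring
  have hDn : ‖D‖ ≠ 0 := norm_ne_zero_iff.2 hD
  -- the factor `κ` is absorbed into the variables
  have hkey := extremal_identity hab (z * κ) (w * κ)
  have e1 : 1 - (b * (z * κ) + a * (w * κ)) = D := by rw [hD_def]; ring
  have e2 : a * (z * κ) + b * (w * κ) - z * κ * (w * κ) =
      (a * z + b * w - z * w * κ) * κ := by ring
  rw [e1, e2, norm_mul z, norm_mul w, norm_mul _ κ, hκ, mul_one, mul_one, mul_one] at hkey
  simp only [SchwarzPickEqualityAt]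
  rw [h1, h2, hfzw]
  simp only [norm_div, norm_mul, norm_pow, Complex.norm_real, Real.norm_of_nonneg ha,
    Real.norm_of_nonneg hb, div_pow]
  rw [← mul_div_assoc, ← mul_div_assoc, ← add_div, hkey, sub_div, div_self (pow_ne_zero 2 hDn)]

theorem IsNormalizedExtremal.everywhere {f : ℂ × ℂ → ℂ} {a b : ℝ}
    (h : IsNormalizedExtremal f a b) {β : ℂ} (hβ : ‖β‖ = 1) (hβ1 : β ≠ 1)
    (hX : ∀ ζ ∈ unitDisk, SchwarzPickEqualityAt f (ζ, β * ζ)) :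
    EverywhereInfinitesimallyExtremal f := by
  obtain ⟨κ, hκ, hslice⟩ := h.exists_slice_eq hβ hβ1 hX
  refine everywhere_extremal_of_eq h.nonneg_left h.nonneg_right h.add_eq_one hκ fun p hp => ?_
  refine sub_eq_zero.1 (eq_zero_of_eq_zero_on_slices (E := fun p =>
    f p * (1 - (b * p.1 + a * p.2) * κ) - (a * p.1 + b * p.2 - p.1 * p.2 * κ)) ?_ ?_ hp)
  · exact (h.holo.1.mul (by fun_prop)).sub (by fun_prop)
  · exact fun β hβ ζ hζ => sub_eq_zero.2 (hslice β hβ ζ hζ)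

/-! ### Reduction to the normal form -/

lemma exists_norm_eq_one_mul_eq_norm (x : ℂ) : ∃ μ : ℂ, ‖μ‖ = 1 ∧ μ * x = ‖x‖ := by
  rcases eq_or_ne x 0 with rfl | hx
  · exact ⟨1, by simp, by simp⟩
  · have hn : (‖x‖ : ℂ) ≠ 0 := by simpa using hx
    exact ⟨‖x‖ / x, by simp [hx], div_mul_cancel₀ _ hx⟩

/-- Every point of the extreme set can be moved to the origin by automorphisms that bring `f` to
normal form. -/
theorem exists_isNormalizedExtremal {f : ℂ × ℂ → ℂ} (hf : IsHolomorphicBidiskToDisk f)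
    {p : ℂ × ℂ} (hp : p ∈ extremeSet f) : ∃ μ ν : ℂ, ‖μ‖ = 1 ∧ ‖ν‖ = 1 ∧ ∃ a b : ℝ,
      IsNormalizedExtremal (fun q => diskMobius (-f p)
        (f (diskMobius p.1 (μ * q.1), diskMobius p.2 (ν * q.2)))) a b := by
  obtain ⟨hpD, hpX⟩ := hp
  obtain ⟨hp1, hp2⟩ := mem_bidisk.1 hpD
  have hfp := mem_unitDisk.1 (hf.2 hpD)
  have hfp' : ‖-f p‖ < 1 := by simpa using hfp
  have hd : ∀ {c μ : ℂ}, ‖c‖ < 1 →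
      HasDerivAt (fun z => diskMobius c (μ * z)) (μ * (1 - ‖c‖ ^ 2 : ℝ)) 0 := by
    intro c μ hc
    have h1 := hasDerivAt_diskMobius (z := μ * 0) hc (by simp)
    have h2 := HasDerivAt.comp (0 : ℂ) h1 (by simpa using (hasDerivAt_id (0 : ℂ)).const_mul μ)
    refine h2.congr_deriv ?_
    simp [mul_comm]
  have hfd : ∀ {x y : ℂ}, x = p.1 → y = p.2 → DifferentiableAt ℂ f (x, y) := by
    rintro x y rfl rfl
    exact hf.1.differentiableAt (isOpen_bidisk.mem_nhds hpD)
  set t : ℂ := deriv (diskMobius (-f p)) (f p) with ht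
  have hτ : ∀ {x y : ℂ}, x = p.1 → y = p.2 →
      HasDerivAt (diskMobius (-f p)) t (f (x, y)) := by
    rintro x y rfl rfl
    exact (hasDerivAt_diskMobius hfp' hfp).differentiableAt.hasDerivAt
  -- the rotations are chosen so that both partial derivatives at the origin are nonnegative
  obtain ⟨μ, hμ, hμx⟩ := exists_norm_eq_one_mul_eq_norm
    (t * ((1 - ‖p.1‖ ^ 2 : ℝ) * partialFst f p))
  obtain ⟨ν, hν, hνx⟩ := exists_norm_eq_one_mul_eq_norm
    (t * ((1 - ‖p.2‖ ^ 2 : ℝ) * partialSnd f p))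
  have hm0 : ∀ {c : ℂ} (μ : ℂ), diskMobius c (μ * 0) = c := fun {c} μ => by
    rw [mul_zero, diskMobius_zero]
  set F : ℂ × ℂ → ℂ := fun q => diskMobius (-f p)
    (f (diskMobius p.1 (μ * q.1), diskMobius p.2 (ν * q.2))) with hF
  have hφ := preservesPoincare_diskMobius_mul hp1 hμ
  have hψ := preservesPoincare_diskMobius_mul hp2 hν
  have hχ := preservesPoincare_diskMobius hfp'
  have hpair : MapsTo (fun q : ℂ × ℂ => (diskMobius p.1 (μ * q.1), diskMobius p.2 (ν * q.2)))
      bidisk bidisk := fun q hq => ⟨hφ.mapsTo hq.1, hψ.mapsTo hq.2⟩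
  have hholo : IsHolomorphicBidiskToDisk F := by
    refine ⟨hχ.differentiableOn.comp (hf.1.comp ?_ hpair) (hf.2.comp hpair),
      hχ.mapsTo.comp (hf.2.comp hpair)⟩
    exact (hφ.differentiableOn.comp differentiableOn_fst fun q hq => hq.1).prodMk
      (hψ.differentiableOn.comp differentiableOn_snd fun q hq => hq.2)
  have hF1 : partialFst F (0, 0) = ‖t * ((1 - ‖p.1‖ ^ 2 : ℝ) * partialFst f p)‖ := by
    have h1 := hasDerivAt_comp_prodMk (f := f) (g := fun z => diskMobius p.1 (μ * z))
      (h := fun _ => diskMobius p.2 (ν * 0)) (hfd (hm0 μ) (hm0 ν)) (hd hp1)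
      (hasDerivAt_const (0 : ℂ) _)
    have h2 := (HasDerivAt.comp (0 : ℂ) (hτ (hm0 μ) (hm0 ν)) h1).deriv
    rw [← hμx]
    refine h2.trans ?_
    simp only [hm0]
    ring
  have hF2 : partialSnd F (0, 0) = ‖t * ((1 - ‖p.2‖ ^ 2 : ℝ) * partialSnd f p)‖ := by
    have h1 := hasDerivAt_comp_prodMk (f := f) (g := fun _ => diskMobius p.1 (μ * 0))
      (h := fun z => diskMobius p.2 (ν * z)) (hfd (hm0 μ) (hm0 ν))
      (hasDerivAt_const (0 : ℂ) _) (hd hp2)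
    have h2 := (HasDerivAt.comp (0 : ℂ) (hτ (hm0 μ) (hm0 ν)) h1).deriv
    rw [← hνx]
    refine h2.trans ?_
    simp only [hm0]
    ring
  have hF0 : F (0, 0) = 0 := by
    simp only [hF, hm0, Prod.mk.eta, diskMobius_neg_self]
  have hsum : SchwarzPickEqualityAt F (0, 0) := by
    refine (schwarzPickEqualityAt_comp hf hφ hψ hχ zero_mem_bidisk).2 ?_
    simpa only [hm0, Prod.mk.eta] using hpX
  refine ⟨μ, ν, hμ, hν, _, _, hholo, hF0, hF1, hF2, norm_nonneg _, norm_nonneg _, ?_⟩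
  simp only [SchwarzPickEqualityAt, hF1, hF2, hF0] at hsum
  simpa using hsum

theorem theorem3 (f : ℂ × ℂ → ℂ) (hf : IsHolomorphicBidiskToDisk f)
    (D₁ D₂ : Set (ℂ × ℂ)) (hD₁ : IsBalancedDisk D₁) (hD₂ : IsBalancedDisk D₂)
    (hX₁ : D₁ ⊆ extremeSet f) (hX₂ : D₂ ⊆ extremeSet f)
    (hne : D₁ ≠ D₂) (hinter : (D₁ ∩ D₂).Nonempty) :
    EverywhereInfinitesimallyExtremal f := by
  obtain ⟨p, hp₁, hp₂⟩ := hinter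
  have hpX := hX₁ hp₁
  obtain ⟨hn1, hn2⟩ := mem_bidisk.1 hpX.1
  have hfp : ‖-f p‖ < 1 := by simpa using mem_unitDisk.1 (hf.2 hpX.1)
  obtain ⟨μ, ν, hμ, hν, a, b, hF⟩ := exists_isNormalizedExtremal hf hpX
  have hμ0 : μ ≠ 0 := norm_ne_zero_iff.1 (by rw [hμ]; exact one_ne_zero)
  have hν0 : ν ≠ 0 := norm_ne_zero_iff.1 (by rw [hν]; exact one_ne_zero)
  have htransport := fun {q : ℂ × ℂ} (hq : q ∈ bidisk) => schwarzPickEqualityAt_comp hf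
    (preservesPoincare_diskMobius_mul hn1 hμ) (preservesPoincare_diskMobius_mul hn2 hν)
    (preservesPoincare_diskMobius hfp) hq
  obtain ⟨γ₁, hγ₁, hDγ₁⟩ := hD₁.exists_eq_image hp₁
  obtain ⟨γ₂, hγ₂, hDγ₂⟩ := hD₂.exists_eq_image hp₂
  -- one of the two balanced disks is not the diagonal in the normalized coordinates
  obtain ⟨γ, hγ, hγν, hXγ⟩ : ∃ γ : ℂ, ‖γ‖ = 1 ∧ γ * μ ≠ ν ∧
      (fun ζ : ℂ => (diskMobius p.1 ζ, diskMobius p.2 (γ * ζ))) '' unitDisk ⊆ extremeSet f := by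
    by_cases h1 : γ₁ * μ = ν
    · refine ⟨γ₂, hγ₂, fun h2 => hne ?_, hDγ₂ ▸ hX₂⟩
      rw [hDγ₁, hDγ₂, mul_right_cancel₀ hμ0 (h1.trans h2.symm)]
    · exact ⟨γ₁, hγ₁, h1, hDγ₁ ▸ hX₁⟩
  have hall := hF.everywhere (β := γ * μ / ν) (by simp [hγ, hμ, hν])
    (fun h => hγν (by rwa [div_eq_one_iff_eq hν0] at h)) fun ζ hζ => by
      have hmem : (ζ, γ * μ / ν * ζ) ∈ bidisk := mk_mul_mem_bidisk (by simp [hγ, hμ, hν]) hζ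
      have hμζ : μ * ζ ∈ unitDisk := by simpa [mem_unitDisk, hμ] using hζ
      refine (htransport hmem).2 ?_
      have e : ν * (γ * μ / ν * ζ) = γ * (μ * ζ) := by field_simp
      simp only [e]
      exact (hXγ ⟨μ * ζ, hμζ, rfl⟩).2
  rintro ⟨z, w⟩ hq
  obtain ⟨hz, hw⟩ := mem_bidisk.1 hq
  have hback : ∀ {c μ z : ℂ}, ‖c‖ < 1 → ‖z‖ < 1 → μ ≠ 0 →
      diskMobius c (μ * (μ⁻¹ * diskMobius (-c) z)) = z := fun hc hz hμ => by
    rw [mul_inv_cancel_left₀ hμ, diskMobius_diskMobius_neg hc hz]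
  have hmem : (μ⁻¹ * diskMobius (-p.1) z, ν⁻¹ * diskMobius (-p.2) w) ∈ bidisk := by
    rw [mem_bidisk]
    simp only [norm_mul, norm_inv, hμ, hν, inv_one, one_mul]
    exact ⟨norm_diskMobius_lt_one (by simpa using hn1) hz,
      norm_diskMobius_lt_one (by simpa using hn2) hw⟩
  have h := (htransport hmem).1 (hall _ hmem)
  simpa only [hback hn1 hz hμ0, hback hn2 hw hν0] using h
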